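/- All graphs are finite and simple. A \emph{cograph} is a graph with no induced path on four vertices. For graphs $G$ and $H$, $G+H$ denotes their disjoint union and $G\oplus H$ their join (the disjoint union together with all edges between $G$ and $H$). A \emph{cluster} is the complement of a complete multipartite graph, that is, a disjoint union of complete graphs; a \emph{$k$-cluster} is a cluster with at most $k$ connected components. For $s,k\in\{0,1,2,\dots\}\cup\{\infty\}$, a graph $G$ is \emph{$(s,k)$-polar} if its vertex set can be partitioned into two (possibly empty) sets $A$ and $B$ such that $A$ induces a complete multipartite graph with at most $s$ parts and $B$ induces a $k$-cluster; the value $\infty$ means that the corresponding number is unbounded. A \emph{cograph minimal $(s,k)$-polar obstruction} is a cograph that is not $(s,k)$-polar, but all of whose proper induced subgraphs are $(s,k)$-polar. \textbf{Theorem.} Let $k\ge 2$ be an integer, and let $G$ be a graph with exactly two connected components, one of which is trivial (a single vertex). Then $G$ is a cograph minimal $(\infty,k)$-polar obstruction if and only if there is a disconnected cograph minimal $(\infty,k-1)$-polar obstruction $H'$ that is $(1,k)$-polar and satisfies $G\cong K_1+(K_1\oplus H')$. -/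

import Mathlib

universe u v

namespace PolarCograph

/-- A cograph is a graph without a path on four vertices as an induced subgraph. -/
def IsCograph {V : Type u} (G : SimpleGraph V) : Prop :=
  ¬ (SimpleGraph.pathGraph 4).IsIndContained G

/-- The join `G ⊕ H`: the disjoint union of `G` and `H` together with all edges between a vertex
of `G` and a vertex of `H`. -/
def join {V : Type u} {W : Type v} (G : SimpleGraph V) (H : SimpleGraph W) :
    SimpleGraph (V ⊕ W) :=
  SimpleGraph.sum G H ⊔ completeBipartiteGraph V W

/-- The one-vertex graph. -/
abbrev K1 : SimpleGraph (Fin 1) := ⊤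

/-- `G` is complete multipartite with at most `s` parts. The parts are the classes of the
equivalence relation "equal or non-adjacent". -/
def IsCompleteMultipartiteAtMost {V : Type u} (s : ℕ∞) (G : SimpleGraph V) : Prop :=
  ∃ h : G.IsCompleteMultipartite, ENat.card (Quotient h.setoid) ≤ s

/-- A cluster is the complement of a complete multipartite graph. -/
def IsCluster {V : Type u} (G : SimpleGraph V) : Prop :=
  Gᶜ.IsCompleteMultipartite

/-- A `k`-cluster is a cluster with at most `k` connected components. -/
def IsClusterAtMost {V : Type u} (k : ℕ∞) (G : SimpleGraph V) : Prop :=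
  IsCluster G ∧ ENat.card G.ConnectedComponent ≤ k

/-- An `(s, k)`-polar partition `(A, B)` of `G` (one of `A` and `B` may be empty); the value `⊤`
of `s` or `k` means that the corresponding number is unbounded. -/
structure IsPolarPartition {V : Type u} (s k : ℕ∞) (G : SimpleGraph V) (A B : Set V) : Prop where
  isCompl : IsCompl A B
  multipartite : IsCompleteMultipartiteAtMost s (G.induce A)
  cluster : IsClusterAtMost k (G.induce B)

/-- `G` is `(s, k)`-polar. -/
def IsPolar {V : Type u} (s k : ℕ∞) (G : SimpleGraph V) : Prop :=
  ∃ A B : Set V, IsPolarPartition s k G A B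

/-- `G` is a cograph minimal `(s, k)`-polar obstruction: a cograph that is not `(s, k)`-polar,
all of whose proper induced subgraphs are `(s, k)`-polar. -/
structure IsCographMinObstruction {V : Type u} (s k : ℕ∞) (G : SimpleGraph V) : Prop where
  isCograph : IsCograph G
  not_isPolar : ¬ IsPolar s k G
  isPolar_induce : ∀ S : Set V, S ≠ Set.univ → IsPolar s k (G.induce S)

end PolarCograph

/-! Write k = j + 1 with j ≥ 1, and let v be the isolated vertex. The heart is
`polarOn_insert_insert_iff`: K₁ + (K₁ ⊕ S) is (∞, j+1)-polar exactly when S is (∞, j)-polar.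
Deleting v, the dominating vertex u or a vertex of S then gives `minimal_iff`: G is minimal iff S is
minimal for (∞, j) and is (1, j+1)-polar, the last condition being what the deletion of u demands.

It remains to find u in a minimal G (`exists_dominating`). The rest C = G − v is a connected
cograph, hence a join X ⊕ Y (`IsCograph.splits`). C is (∞, j+1)-polar but not (∞, j)-polar, so the
cluster side of a partition of C has two nonadjacent vertices, both in X, say. This forces Y into
the multipartite side, and minimality makes Y a single vertex u (`exists_eq_singleton_of_join`). If
S = C − u were again a join D ⊕ E, the same argument for D ⊕ ({u} ∪ E) and for E ⊕ ({u} ∪ D) would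
make C a triangle, which is a 1-cluster; so S is disconnected. -/

namespace PolarCograph

/-! ### Polarity through colourings by natural numbers, transported along embeddings. -/

section Colourings

variable {V : Type*} {W : Type*} {G : SimpleGraph V} {H : SimpleGraph W}

/-- `G` induces on `A` a complete multipartite graph with at most `s` parts; the parts are the
colour classes of a colouring by natural numbers below `s`. -/
def MultOn (G : SimpleGraph V) (s : ℕ∞) (A : Set V) : Prop :=
  ∃ f : V → ℕ, (∀ x ∈ A, (f x : ℕ∞) < s) ∧ ∀ x ∈ A, ∀ y ∈ A, (G.Adj x y ↔ f x ≠ f y)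

/-- `G` induces on `B` a cluster with at most `k` components; the components are the
colour classes of a colouring by natural numbers below `k`. -/
def ClusOn (G : SimpleGraph V) (k : ℕ∞) (B : Set V) : Prop :=
  ∃ f : V → ℕ, (∀ x ∈ B, (f x : ℕ∞) < k) ∧
    ∀ x ∈ B, ∀ y ∈ B, x ≠ y → (G.Adj x y ↔ f x = f y)

/-- The subgraph of `G` induced on `S` is `(s, k)`-polar. -/
def PolarOn (G : SimpleGraph V) (s k : ℕ∞) (S : Set V) : Prop :=
  ∃ A B : Set V, S ⊆ A ∪ B ∧ MultOn G s A ∧ ClusOn G k B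

theorem MultOn.subset {s : ℕ∞} {A A' : Set V} (h : MultOn G s A) (hA : A' ⊆ A) :
    MultOn G s A' := by
  obtain ⟨f, hf, hadj⟩ := h
  exact ⟨f, fun x hx => hf x (hA hx), fun x hx y hy => hadj x (hA hx) y (hA hy)⟩

theorem ClusOn.subset {k : ℕ∞} {B B' : Set V} (h : ClusOn G k B) (hB : B' ⊆ B) :
    ClusOn G k B' := by
  obtain ⟨f, hf, hadj⟩ := h
  exact ⟨f, fun x hx => hf x (hB hx), fun x hx y hy => hadj x (hB hx) y (hB hy)⟩

theorem PolarOn.subset {s k : ℕ∞} {S T : Set V} (h : PolarOn G s k S) (hT : T ⊆ S) :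
    PolarOn G s k T := by
  obtain ⟨A, B, hS, hA, hB⟩ := h
  exact ⟨A, B, hT.trans hS, hA, hB⟩

/-- A quotient of a finite type has at most `s` classes if and only if the classes can be
numbered by natural numbers below `s`. -/
theorem card_le_iff_exists_colouring {Q : Type*} [Finite V] {π : V → Q}
    (hπ : Function.Surjective π) (s : ℕ∞) :
    ENat.card Q ≤ s ↔
      ∃ f : V → ℕ, (∀ x, (f x : ℕ∞) < s) ∧ ∀ x y, f x = f y ↔ π x = π y := by
  have : Finite Q := Finite.of_surjective π hπ
  constructor
  · intro h
    obtain ⟨n, ⟨e⟩⟩ := Finite.exists_equiv_fin Q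
    refine ⟨fun x => e (π x), fun x => ?_, fun x y => ?_⟩
    · refine lt_of_lt_of_le ?_ h
      rw [ENat.card_congr e, ENat.card_eq_coe_fintype_card, Fintype.card_fin]
      exact_mod_cast (e (π x)).2
    · rw [← Fin.ext_iff, e.injective.eq_iff]
  · rintro ⟨f, hf, hfπ⟩
    induction s with
    | top => exact le_top
    | coe n =>
      have hlt : ∀ x, f x < n := fun x => by exact_mod_cast hf x
      let g : Q → Fin n := fun q => ⟨f (Function.surjInv hπ q), hlt _⟩
      have hg : Function.Injective g := by
        intro p q hpq
        have := (hfπ _ _).1 (congrArg Fin.val hpq)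
        rwa [Function.surjInv_eq hπ, Function.surjInv_eq hπ] at this
      refine (ENat.card_le_card_of_injective hg).trans ?_
      rw [ENat.card_eq_coe_fintype_card, Fintype.card_fin]

theorem isCompleteMultipartiteAtMost_iff [Finite V] (s : ℕ∞) :
    IsCompleteMultipartiteAtMost s G ↔ MultOn G s Set.univ := by
  constructor
  · rintro ⟨h, hs⟩
    obtain ⟨f, hf, hfq⟩ := (card_le_iff_exists_colouring (π := Quotient.mk h.setoid)
      Quotient.mk_surjective s).1 hs
    refine ⟨f, fun x _ => hf x, fun x _ y _ => ?_⟩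
    rw [Ne, hfq, Quotient.eq]
    exact not_not.symm
  · rintro ⟨f, hf, hadj⟩
    have h : G.IsCompleteMultipartite := by
      refine ⟨fun x y z hxy hyz => ?_⟩
      simp only [hadj _ trivial _ trivial, not_not] at *
      exact hxy.trans hyz
    refine ⟨h, (card_le_iff_exists_colouring (π := Quotient.mk h.setoid)
      Quotient.mk_surjective s).2 ⟨f, fun x => hf x trivial, fun x y => ?_⟩⟩
    rw [Quotient.eq]
    change _ ↔ ¬ G.Adj x y
    rw [hadj _ trivial _ trivial, not_not]

/-- In a cluster "equal or adjacent" is transitive, so a walk collapses to at most one edge. -/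
theorem IsCluster.eq_or_adj_of_reachable (h : IsCluster G) {x y : V} (hxy : G.Reachable x y) :
    x = y ∨ G.Adj x y := by
  obtain ⟨p⟩ := hxy
  induction p with
  | nil => exact Or.inl rfl
  | @cons a b c hab _ ih =>
    rcases ih with rfl | hbc
    · exact Or.inr hab
    · by_cases hac : a = c
      · exact Or.inl hac
      · right
        have := h.trans a b c (by simp [hab]) (by simp [hbc])
        simpa [hac] using this

theorem isClusterAtMost_iff [Finite V] (k : ℕ∞) :
    IsClusterAtMost k G ↔ ClusOn G k Set.univ := by
  have hsurj : Function.Surjective G.connectedComponentMk := fun c => c.exists_rep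
  constructor
  · rintro ⟨h, hk⟩
    obtain ⟨f, hf, hfq⟩ := (card_le_iff_exists_colouring hsurj k).1 hk
    refine ⟨f, fun x _ => hf x, fun x _ y _ hxy => ?_⟩
    rw [hfq, SimpleGraph.ConnectedComponent.eq]
    exact ⟨fun h => h.reachable, fun hr => (h.eq_or_adj_of_reachable hr).resolve_left hxy⟩
  · rintro ⟨f, hf, hadj⟩
    have h : IsCluster G := by
      refine ⟨fun x y z hxy hyz => ?_⟩
      have key : ∀ a b, ¬ Gᶜ.Adj a b ↔ f a = f b ∧ ¬ Gᶜ.Adj a b := by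
        intro a b
        by_cases hab : a = b
        · simp [hab]
        · simp [hab, hadj _ trivial _ trivial hab]
      have h1 := (key _ _).1 hxy
      have h2 := (key _ _).1 hyz
      by_cases hxz : x = z
      · simp [hxz]
      · simp [hxz, hadj _ trivial _ trivial hxz, h1.1.trans h2.1]
    refine ⟨h, (card_le_iff_exists_colouring hsurj k).2 ?_⟩
    refine ⟨f, fun x => hf x trivial, fun x y => ?_⟩
    rw [SimpleGraph.ConnectedComponent.eq]
    by_cases hxy : x = y
    · simp [hxy]
    · rw [← hadj _ trivial _ trivial hxy]
      exact ⟨fun h => h.reachable, fun hr => (h.eq_or_adj_of_reachable hr).resolve_left hxy⟩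

theorem multOn_image_iff (e : H ↪g G) (s : ℕ∞) (S : Set W) :
    MultOn G s (e '' S) ↔ MultOn H s S := by
  constructor
  · rintro ⟨f, hf, hadj⟩
    refine ⟨f ∘ e, fun x hx => hf _ ⟨x, hx, rfl⟩, fun x hx y hy => ?_⟩
    rw [← e.map_adj_iff, hadj _ ⟨x, hx, rfl⟩ _ ⟨y, hy, rfl⟩]; rfl
  · rintro ⟨f, hf, hadj⟩
    -- The default colour 0 off the range of `e` is never inspected.
    have hext : ∀ x, Function.extend e f 0 (e x) = f x := e.injective.extend_apply f 0
    refine ⟨Function.extend e f 0, ?_, ?_⟩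
    · rintro _ ⟨x, hx, rfl⟩
      rw [hext]; exact hf x hx
    · rintro _ ⟨x, hx, rfl⟩ _ ⟨y, hy, rfl⟩
      rw [hext, hext, e.map_adj_iff, hadj x hx y hy]

theorem clusOn_image_iff (e : H ↪g G) (k : ℕ∞) (S : Set W) :
    ClusOn G k (e '' S) ↔ ClusOn H k S := by
  constructor
  · rintro ⟨f, hf, hadj⟩
    refine ⟨f ∘ e, fun x hx => hf _ ⟨x, hx, rfl⟩, fun x hx y hy hxy => ?_⟩
    rw [← e.map_adj_iff, hadj _ ⟨x, hx, rfl⟩ _ ⟨y, hy, rfl⟩ (e.injective.ne hxy)]; rfl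
  · rintro ⟨f, hf, hadj⟩
    have hext : ∀ x, Function.extend e f 0 (e x) = f x := e.injective.extend_apply f 0
    refine ⟨Function.extend e f 0, ?_, ?_⟩
    · rintro _ ⟨x, hx, rfl⟩
      rw [hext]; exact hf x hx
    · rintro _ ⟨x, hx, rfl⟩ _ ⟨y, hy, rfl⟩ hxy
      rw [hext, hext, e.map_adj_iff, hadj x hx y hy (fun h => hxy (congrArg e h))]

theorem polarOn_image_iff (e : H ↪g G) (s k : ℕ∞) (S : Set W) :
    PolarOn G s k (e '' S) ↔ PolarOn H s k S := by
  constructor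
  · rintro ⟨A, B, hS, hA, hB⟩
    refine ⟨e ⁻¹' A, e ⁻¹' B, fun x hx => hS ⟨x, hx, rfl⟩, ?_, ?_⟩
    · exact (multOn_image_iff e s _).1 (hA.subset (Set.image_preimage_subset _ _))
    · exact (clusOn_image_iff e k _).1 (hB.subset (Set.image_preimage_subset _ _))
  · rintro ⟨A, B, hS, hA, hB⟩
    refine ⟨e '' A, e '' B, ?_, (multOn_image_iff e s _).2 hA, (clusOn_image_iff e k _).2 hB⟩
    rw [← Set.image_union]
    exact Set.image_mono hS

theorem range_embedding_induce (A : Set V) :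
    Set.range (SimpleGraph.Embedding.induce (G := G) A) = A :=
  Subtype.range_coe

theorem isCompleteMultipartiteAtMost_induce_iff [Finite V] (s : ℕ∞) (A : Set V) :
    IsCompleteMultipartiteAtMost s (G.induce A) ↔ MultOn G s A := by
  rw [isCompleteMultipartiteAtMost_iff,
    ← multOn_image_iff (SimpleGraph.Embedding.induce (G := G) A)]
  rw [Set.image_univ, range_embedding_induce]

theorem isClusterAtMost_induce_iff [Finite V] (k : ℕ∞) (B : Set V) :
    IsClusterAtMost k (G.induce B) ↔ ClusOn G k B := by
  rw [isClusterAtMost_iff, ← clusOn_image_iff (SimpleGraph.Embedding.induce (G := G) B)]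
  rw [Set.image_univ, range_embedding_induce]

/-- A cover is as good as a partition: clusters are hereditary, so `B` can be cut down to `Aᶜ`. -/
theorem isPolar_iff [Finite V] (s k : ℕ∞) : IsPolar s k G ↔ PolarOn G s k Set.univ := by
  constructor
  · rintro ⟨A, B, hAB, hA, hB⟩
    exact ⟨A, B, (hAB.sup_eq_top).ge, (isCompleteMultipartiteAtMost_induce_iff s A).1 hA,
      (isClusterAtMost_induce_iff k B).1 hB⟩
  · rintro ⟨A, B, hS, hA, hB⟩
    refine ⟨A, Aᶜ, isCompl_compl, (isCompleteMultipartiteAtMost_induce_iff s A).2 hA,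
      (isClusterAtMost_induce_iff k _).2 (hB.subset fun x hx => ?_)⟩
    exact (hS trivial).resolve_left hx

theorem isPolar_induce_iff [Finite V] (s k : ℕ∞) (S : Set V) :
    IsPolar s k (G.induce S) ↔ PolarOn G s k S := by
  rw [isPolar_iff, ← polarOn_image_iff (SimpleGraph.Embedding.induce (G := G) S)]
  rw [Set.image_univ, range_embedding_induce]

/-- Minimal obstructions, expressed inside an ambient graph. -/
theorem isCographMinObstruction_iff_of_embedding [Finite V] (e : H ↪g G) (s k : ℕ∞) :
    IsCographMinObstruction s k H ↔ IsCograph H ∧ ¬ PolarOn G s k (Set.range e) ∧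
      ∀ T ⊂ Set.range e, PolarOn G s k T := by
  have : Finite W := Finite.of_injective e e.injective
  constructor
  · rintro ⟨h1, h2, h3⟩
    refine ⟨h1, ?_, fun T hT => ?_⟩
    · rwa [← Set.image_univ, polarOn_image_iff, ← isPolar_iff]
    · have h := h3 (e ⁻¹' T) (fun h => hT.2 ?_)
      · rwa [isPolar_induce_iff, ← polarOn_image_iff e,
          Set.image_preimage_eq_of_subset hT.1] at h
      · rintro _ ⟨x, rfl⟩
        exact (h ▸ Set.mem_univ x : x ∈ e ⁻¹' T)
  · rintro ⟨h1, h2, h3⟩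
    refine ⟨h1, ?_, fun S hS => ?_⟩
    · rwa [isPolar_iff, ← polarOn_image_iff e, Set.image_univ]
    · rw [isPolar_induce_iff, ← polarOn_image_iff e]
      refine h3 _ ⟨Set.image_subset_range _ _, fun h => hS (Set.eq_univ_of_forall fun x => ?_)⟩
      exact (e.injective.mem_set_image).1 (h ⟨x, rfl⟩)

end Colourings

/-! ### Polar partitions with an isolated or a dominating vertex. -/

section Partitions

variable {V : Type*} {G : SimpleGraph V}

theorem multOn_of_forall_not_adj {s : ℕ∞} (hs : 1 ≤ s) {A : Set V}
    (h : ∀ x ∈ A, ∀ y ∈ A, ¬ G.Adj x y) : MultOn G s A :=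
  ⟨fun _ => 0, fun _ _ => by simpa using one_pos.trans_le hs,
    fun x hx y hy => by simpa using h x hx y hy⟩

theorem MultOn.not_adj {A : Set V} (h : MultOn G 1 A) {x y : V} (hx : x ∈ A) (hy : y ∈ A) :
    ¬ G.Adj x y := by
  obtain ⟨f, hf, hadj⟩ := h
  have hx0 : f x < 1 := by exact_mod_cast hf x hx
  have hy0 : f y < 1 := by exact_mod_cast hf y hy
  rw [hadj x hx y hy]
  omega

theorem multOn_top_of_isClique [Finite V] {A : Set V} (h : G.IsClique A) : MultOn G ⊤ A := by
  obtain ⟨f, hf⟩ := exists_injective_nat V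
  refine ⟨f, fun x _ => ENat.natCast_lt_top _, fun x hx y hy => ?_⟩
  rw [hf.ne_iff]
  exact ⟨fun hxy => hxy.ne, fun hxy => h hx hy hxy⟩

theorem clusOn_of_isClique {k : ℕ∞} (hk : 1 ≤ k) {B : Set V} (h : G.IsClique B) :
    ClusOn G k B :=
  ⟨fun _ => 0, fun _ _ => by simpa using one_pos.trans_le hk,
    fun x hx y hy hxy => by simpa using h hx hy hxy⟩

/-- The join of two complete multipartite graphs is complete multipartite. -/
theorem MultOn.union {A A' : Set V} (h : MultOn G ⊤ A) (h' : MultOn G ⊤ A')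
    (hj : ∀ x ∈ A, ∀ y ∈ A', G.Adj x y) : MultOn G ⊤ (A ∪ A') := by
  classical
  obtain ⟨f, -, hf⟩ := h
  obtain ⟨g, -, hg⟩ := h'
  have hd : ∀ x ∈ A', x ∉ A := fun x hx' hx => (hj x hx x hx').ne rfl
  -- Parity keeps the colours of the two sides apart.
  refine ⟨fun x => if x ∈ A then 2 * f x else 2 * g x + 1, fun x _ => ENat.natCast_lt_top _, ?_⟩
  rintro x (hx | hx) y (hy | hy)
  · simp only [hx, hy, if_true, hf x hx y hy]; omega
  · simp only [hx, hd y hy, if_true, if_false, hj x hx y hy, true_iff]; omega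
  · simp only [hd x hx, hy, if_true, if_false, (hj y hy x hx).symm, true_iff]; omega
  · simp only [hd x hx, hd y hy, if_false, hg x hx y hy]; omega

/-- A cluster and an isolated vertex form a cluster with one more component. -/
theorem ClusOn.insert_isolated {j : ℕ} {B : Set V} {v : V} (h : ClusOn G j B)
    (hv : ∀ x, ¬ G.Adj v x) (hvB : v ∉ B) : ClusOn G (j + 1 : ℕ) (insert v B) := by
  classical
  obtain ⟨f, hf, hadj⟩ := h
  have hlt : ∀ x ∈ B, f x < j := fun x hx => by exact_mod_cast hf x hx
  have hne : ∀ x ∈ B, x ≠ v := fun x hx h => hvB (h ▸ hx)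
  refine ⟨fun x => if x = v then j else f x, ?_, ?_⟩
  · rintro x (rfl | hx)
    · simp only [if_true]; exact_mod_cast Nat.lt_succ_self j
    · simp only [hne x hx, if_false]; exact_mod_cast (hlt x hx).trans (Nat.lt_succ_self j)
  · rintro x (rfl | hx) y (rfl | hy) hxy
    · exact absurd rfl hxy
    · have := hlt y hy
      simp only [hne y hy, if_true, if_false, hv, false_iff]; omega
    · have := hlt x hx
      have hn : ¬ G.Adj x y := fun h => hv _ h.symm
      simp only [hne x hx, if_true, if_false, hn, false_iff]; omega
    · simp only [hne x hx, hne y hy, if_false]; exact hadj x hx y hy hxy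

/-- Removing a component from a cluster. -/
theorem clusOn_of_forall_ne {j : ℕ} {B : Set V} {f : V → ℕ} {c : ℕ} (hc : c < j + 1)
    (hf : ∀ x ∈ B, f x < j + 1) (hcf : ∀ x ∈ B, f x ≠ c)
    (hadj : ∀ x ∈ B, ∀ y ∈ B, x ≠ y → (G.Adj x y ↔ f x = f y)) : ClusOn G j B := by
  -- The top colour `j` is renamed to the free colour `c`, so that all colours lie below `j`.
  refine ⟨fun x => if f x = j then c else f x, fun x hx => ?_, fun x hx y hy hxy => ?_⟩
  · have h1 := hf x hx
    have h2 := hcf x hx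
    have : (if f x = j then c else f x) < j := by split_ifs <;> omega
    exact_mod_cast this
  · have h1 := hcf x hx
    have h2 := hcf y hy
    rw [hadj x hx y hy hxy]
    dsimp only
    split_ifs <;> omega

theorem ClusOn.diff_isolated {j : ℕ} {B : Set V} {v : V} (h : ClusOn G (j + 1 : ℕ) B)
    (hv : ∀ x, ¬ G.Adj v x) (hvB : v ∈ B) : ClusOn G j (B \ {v}) := by
  obtain ⟨f, hf, hadj⟩ := h
  have hlt : ∀ x ∈ B, f x < j + 1 := fun x hx => by exact_mod_cast hf x hx
  refine clusOn_of_forall_ne (hlt v hvB) (fun x hx => hlt x hx.1) (fun x hx hxv => ?_)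
    (fun x hx y hy hxy => hadj x hx.1 y hy.1 hxy)
  exact hv x ((hadj v hvB x hx.1 (Ne.symm hx.2)).2 hxv.symm)

/-- A component of a cluster can be moved to the complete multipartite side. -/
theorem ClusOn.polarOn_top [Finite V] {j : ℕ} {S : Set V} (h : ClusOn G (j + 1 : ℕ) S) :
    PolarOn G ⊤ j S := by
  obtain ⟨f, hf, hadj⟩ := h
  have hlt : ∀ x ∈ S, f x < j + 1 := fun x hx => by exact_mod_cast hf x hx
  refine ⟨{x ∈ S | f x = 0}, {x ∈ S | f x ≠ 0}, fun x hx => ?_, ?_, ?_⟩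
  · by_cases h0 : f x = 0
    · exact Or.inl ⟨hx, h0⟩
    · exact Or.inr ⟨hx, h0⟩
  · exact multOn_top_of_isClique fun x hx y hy hxy =>
      (hadj x hx.1 y hy.1 hxy).2 (hx.2.trans hy.2.symm)
  · exact clusOn_of_forall_ne (Nat.succ_pos j) (fun x hx => hlt x hx.1) (fun x hx => hx.2)
      (fun x hx y hy hxy => hadj x hx.1 y hy.1 hxy)

/-- A cluster containing a vertex adjacent to all the others is complete. -/
theorem ClusOn.isClique {k : ℕ∞} {B S : Set V} {u : V} (h : ClusOn G k B) (hu : u ∈ B)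
    (hS : S ⊆ B) (huS : ∀ x ∈ S, G.Adj u x) : G.IsClique S := by
  obtain ⟨f, -, hadj⟩ := h
  have hfu : ∀ x ∈ S, f u = f x := fun x hx => (hadj u hu x (hS hx) (huS x hx).ne).1 (huS x hx)
  exact fun x hx y hy hxy =>
    (hadj x (hS hx) y (hS hy) hxy).2 ((hfu x hx).symm.trans (hfu y hy))

/-- A complete multipartite graph with an isolated vertex has no edges. -/
theorem MultOn.not_adj_of_isolated {s : ℕ∞} {A : Set V} {v : V} (h : MultOn G s A) (hvA : v ∈ A)
    (hv : ∀ x, ¬ G.Adj v x) {x y : V} (hx : x ∈ A) (hy : y ∈ A) : ¬ G.Adj x y := by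
  obtain ⟨f, -, hadj⟩ := h
  have hfv : ∀ x ∈ A, f v = f x := fun x hx => not_not.1 ((hadj v hvA x hx).not.1 (hv x))
  rw [hadj x hx y hy, not_not]
  exact (hfv x hx).symm.trans (hfv y hy)

theorem PolarOn.insert_isolated {j : ℕ} {s : ℕ∞} {S : Set V} {v : V} (h : PolarOn G s j S)
    (hv : ∀ x, ¬ G.Adj v x) : PolarOn G s (j + 1 : ℕ) (insert v S) := by
  obtain ⟨A, B, hS, hA, hB⟩ := h
  refine ⟨A, insert v (B \ {v}), ?_, hA,
    (hB.subset Set.sdiff_subset).insert_isolated hv (fun h => h.2 rfl)⟩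
  rintro x (rfl | hx)
  · exact Or.inr (Or.inl rfl)
  · by_cases hxv : x = v
    · exact Or.inr (Or.inl hxv)
    · exact (hS hx).imp_right fun h => Or.inr ⟨h, hxv⟩

theorem PolarOn.insert_dominating {k : ℕ∞} {S : Set V} {u : V} (h : PolarOn G ⊤ k S)
    (hu : ∀ x ∈ S, G.Adj u x) : PolarOn G ⊤ k (insert u S) := by
  obtain ⟨A, B, hS, hA, hB⟩ := h
  -- `u` becomes a part of its own; `A` is cut down to `S`, where `u` is known to be adjacent to
  -- everything.
  refine ⟨{u} ∪ (A ∩ S), B, ?_, MultOn.union ?_ (hA.subset Set.inter_subset_left) ?_, hB⟩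
  · rintro x (rfl | hx)
    · exact Or.inl (Or.inl rfl)
    · exact (hS hx).imp_left fun h => Or.inr ⟨h, hx⟩
  · refine multOn_of_forall_not_adj le_top ?_
    rintro x rfl y rfl
    exact G.irrefl
  · rintro x rfl y hy
    exact hu y hy.2

/-- Adding an isolated vertex on the complete multipartite side. -/
theorem PolarOn.one_insert_isolated {k : ℕ∞} {S : Set V} {v : V} (h : PolarOn G 1 k S)
    (hv : ∀ x, ¬ G.Adj v x) : PolarOn G 1 k (insert v S) := by
  obtain ⟨A, B, hS, hA, hB⟩ := h
  refine ⟨insert v A, B, ?_, multOn_of_forall_not_adj le_rfl ?_, hB⟩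
  · rintro x (rfl | hx)
    · exact Or.inl (Or.inl rfl)
    · exact (hS hx).imp_left Or.inr
  · rintro x (rfl | hx) y (rfl | hy)
    · exact G.irrefl
    · exact hv y
    · exact fun h => hv _ h.symm
    · exact hA.not_adj hx hy

theorem MultOn.to_top {s : ℕ∞} {A : Set V} (h : MultOn G s A) : MultOn G ⊤ A := by
  obtain ⟨f, -, hadj⟩ := h
  exact ⟨f, fun x _ => ENat.natCast_lt_top _, hadj⟩

theorem PolarOn.to_top {s k : ℕ∞} {S : Set V} (h : PolarOn G s k S) : PolarOn G ⊤ k S := by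
  obtain ⟨A, B, hS, hA, hB⟩ := h
  exact ⟨A, B, hS, hA.to_top, hB⟩

/-- A polar partition of a graph with an isolated vertex `v`: either `v` lies on the complete
multipartite side, which is then independent, or on the cluster side. -/
theorem PolarOn.of_insert_isolated {j : ℕ} {s : ℕ∞} {S : Set V} {v : V}
    (h : PolarOn G s (j + 1 : ℕ) (insert v S)) (hv : ∀ x, ¬ G.Adj v x) (hvS : v ∉ S) :
    PolarOn G 1 (j + 1 : ℕ) S ∨ PolarOn G s j S := by
  obtain ⟨A, B, hS, hA, hB⟩ := h
  have hS' : S ⊆ A ∪ B := (Set.subset_insert v S).trans hS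
  rcases hS (Set.mem_insert v S) with hvA | hvB
  · exact Or.inl ⟨A, B, hS', multOn_of_forall_not_adj le_rfl
      fun x hx y hy => hA.not_adj_of_isolated hvA hv hx hy, hB⟩
  · refine Or.inr ⟨A, B \ {v}, fun x hx => ?_, hA, hB.diff_isolated hv hvB⟩
    exact (hS' hx).imp_right fun h => ⟨h, fun hxv => hvS (hxv ▸ hx)⟩

/-- If `u` is on the cluster side, the vertices of `S` there are all adjacent to `u` and form a
clique. One component then suffices, whence any bound `j ≥ 1` is allowed. -/
theorem polarOn_insert_dominating_cases {s k : ℕ∞} {S : Set V} {u : V}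
    (h : PolarOn G s k (insert u S)) (hu : ∀ x ∈ S, G.Adj u x) {j : ℕ∞} (hj : 1 ≤ j) :
    PolarOn G s j S ∨ ∃ A B, u ∈ A ∧ S ⊆ A ∪ B ∧ MultOn G s A ∧ ClusOn G k B := by
  obtain ⟨A, B, hS, hA, hB⟩ := h
  have hS' : S ⊆ A ∪ B := (Set.subset_insert u S).trans hS
  rcases hS (Set.mem_insert u S) with huA | huB
  · exact Or.inr ⟨A, B, huA, hS', hA, hB⟩
  · refine Or.inl ⟨A, B ∩ S, fun x hx => (hS' hx).imp_right fun h => ⟨h, hx⟩, hA, ?_⟩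
    exact clusOn_of_isClique hj (hB.isClique huB Set.inter_subset_left fun x hx => hu x hx.2)

/-- `K₁ + (K₁ ⊕ S)` is `(∞, j + 1)`-polar if and only if `S` is `(∞, j)`-polar. -/
theorem polarOn_insert_insert_iff [Finite V] {j : ℕ} (hj : 1 ≤ j) {S : Set V} {u v : V}
    (hv : ∀ x, ¬ G.Adj v x) (huv : v ≠ u) (hvS : v ∉ S) (hu : ∀ x ∈ S, G.Adj u x) :
    PolarOn G ⊤ (j + 1 : ℕ) (insert v (insert u S)) ↔ PolarOn G ⊤ j S := by
  have hj' : (1 : ℕ∞) ≤ j := by exact_mod_cast hj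
  refine ⟨fun h => ?_, fun h => (h.insert_dominating hu).insert_isolated hv⟩
  rcases h.of_insert_isolated hv (by simp [huv, hvS]) with h | h
  · rcases polarOn_insert_dominating_cases h hu hj' with h | ⟨A, B, huA, hS, hA, hB⟩
    · exact h.to_top
    -- Here `A` is independent and contains `u`, so `S` misses `A`: it is a (j+1)-cluster, and one
    -- of its components can change sides.
    · refine (hB.subset fun x hx => ?_).polarOn_top
      exact (hS hx).resolve_left fun hxA => hA.not_adj huA hxA (hu x hx)
  · rcases polarOn_insert_dominating_cases h hu hj' with h | ⟨A, B, huA, hS, hA, hB⟩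
    · exact h
    · exact ⟨A, B, hS, hA, hB⟩

/-- Minimality of `K₁ + (K₁ ⊕ S)` in terms of `S`. -/
theorem minimal_iff [Finite V] {j : ℕ} (hj : 1 ≤ j) {S : Set V} {u v : V}
    (hv : ∀ x, ¬ G.Adj v x) (huv : v ≠ u) (hvS : v ∉ S) (hu : ∀ x ∈ S, G.Adj u x)
    (huniv : Set.univ = insert v (insert u S)) :
    (¬ PolarOn G ⊤ (j + 1 : ℕ) Set.univ ∧
        ∀ T ⊂ Set.univ, PolarOn G ⊤ (j + 1 : ℕ) T) ↔
      ((¬ PolarOn G ⊤ j S ∧ ∀ T ⊂ S, PolarOn G ⊤ j T) ∧ PolarOn G 1 (j + 1 : ℕ) S) := by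
  have huS : u ∉ S := fun h => G.irrefl (hu u h)
  constructor
  · rintro ⟨h1, h2⟩
    have h3 : ¬ PolarOn G ⊤ j S := by
      rwa [huniv, polarOn_insert_insert_iff hj hv huv hvS hu] at h1
    refine ⟨⟨h3, fun T hT => ?_⟩, ?_⟩
    · obtain ⟨x, hxS, hxT⟩ := Set.exists_of_ssubset hT
      rw [← polarOn_insert_insert_iff hj hv huv (fun h => hvS (hT.1 h))
        (fun y hy => hu y (hT.1 hy))]
      refine h2 _ ⟨Set.subset_univ _, fun h => ?_⟩
      rcases h (Set.mem_univ x) with rfl | rfl | h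
      · exact hvS hxS
      · exact huS hxS
      · exact hxT h
    -- Delete `u`: as `S` is not (∞, j)-polar, `v` must lie on the multipartite side, which is then
    -- independent.
    · refine ((h2 (insert v S) ⟨Set.subset_univ _, fun h => ?_⟩).of_insert_isolated
        hv hvS).resolve_right h3
      rcases h (Set.mem_univ u) with h | h
      · exact huv h.symm
      · exact huS h
  · rintro ⟨⟨h1, h2⟩, h3⟩
    refine ⟨by rwa [huniv, polarOn_insert_insert_iff hj hv huv hvS hu], fun T hT => ?_⟩
    obtain ⟨x, hx, hxT⟩ := Set.exists_of_ssubset hT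
    have hT' : T ⊆ insert v (insert u S) := huniv ▸ Set.subset_univ T
    rw [huniv] at hx
    rcases hx with rfl | rfl | hx
    -- `v` is missing: `u` becomes one more part.
    · refine (h3.to_top.insert_dominating hu).subset fun y hy => ?_
      exact (hT' hy).resolve_left fun h => hxT (h ▸ hy)
    -- `u` is missing: `v` joins the independent side.
    · refine (h3.one_insert_isolated hv).to_top.subset fun y hy => ?_
      exact (hT' hy).imp_right fun h => h.resolve_left fun h => hxT (h ▸ hy)
    · have h4 := h2 (S \ {x}) ⟨Set.sdiff_subset, fun h => (h hx).2 rfl⟩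
      rw [← polarOn_insert_insert_iff hj hv huv (fun h => hvS h.1)
        (fun y hy => hu y hy.1)] at h4
      refine h4.subset fun y hy => ?_
      exact (hT' hy).imp_right fun h => h.imp_right fun h => ⟨h, fun hyx => hxT (hyx ▸ hy)⟩

/-- If the nontrivial part of a minimal obstruction `K₁ + C` is a join of `X` and `Y` and the
cluster side of some polar partition of `C` has two nonadjacent vertices in `X`, then `Y` is a
single vertex. -/
theorem exists_eq_singleton_of_join_aux [Finite V] {j : ℕ} (hj : 1 ≤ j) {v : V} {X Y A B : Set V}
    (hv : ∀ x, ¬ G.Adj v x) (hX : v ∉ X) (hY : v ∉ Y) (hYne : Y.Nonempty)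
    (hXY : ∀ x ∈ X, ∀ y ∈ Y, G.Adj x y)
    (hpol : ∀ T ⊂ Set.univ, PolarOn G ⊤ (j + 1 : ℕ) T)
    (hS : X ∪ Y ⊆ A ∪ B) (hA : MultOn G ⊤ A) (hB : ClusOn G (j + 1 : ℕ) B)
    (hno : ¬ PolarOn G ⊤ j (X ∪ Y)) {p q : V} (hp : p ∈ B ∩ X) (hq : q ∈ B ∩ X)
    (hpq : p ≠ q) (hnadj : ¬ G.Adj p q) :
    ∃ y, Y = {y} ∧ ¬ PolarOn G ⊤ j X := by
  -- A vertex of `Y` in the cluster `B` would be adjacent to both `p` and `q`, putting them in one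
  -- component.
  have hYA : Y ⊆ A := by
    intro y hy
    refine (hS (Or.inr hy)).resolve_right fun hyB => hnadj ?_
    refine hB.isClique (S := {p, q}) hyB (by rintro _ (rfl | rfl) <;> simp [hp.1, hq.1]) ?_
      (by simp) (by simp) hpq
    rintro _ (rfl | rfl)
    exacts [(hXY _ hp.2 _ hy).symm, (hXY _ hq.2 _ hy).symm]
  have hXno : ¬ PolarOn G ⊤ j X := by
    rintro ⟨A', B', hS', hA', hB'⟩
    refine hno ⟨(A' ∩ X) ∪ Y, B', ?_, ?_, hB'⟩
    · rintro x (hx | hx)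
      · exact (hS' hx).imp_left fun h => Or.inl ⟨h, hx⟩
      · exact Or.inl (Or.inr hx)
    · exact (hA'.subset Set.inter_subset_left).union (hA.subset hYA)
        fun x hx y hy => hXY x hx.2 y hy
  obtain ⟨y, hy⟩ := hYne
  refine ⟨y, Set.eq_singleton_iff_unique_mem.2 ⟨hy, fun z hz => ?_⟩, hXno⟩
  by_contra hzy
  -- A second vertex `z` of `Y` may be deleted; what is left still contains K₁ + (K₁ ⊕ X), with `y`
  -- as dominating vertex.
  refine hXno ((polarOn_insert_insert_iff (u := y) hj hv (fun h => hY (h ▸ hy)) hX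
    fun x hx => (hXY x hx y hy).symm).1 (hpol _ ⟨Set.subset_univ _, fun h => ?_⟩))
  rcases h (Set.mem_univ z) with rfl | rfl | h
  · exact hY hz
  · exact hzy rfl
  · exact G.irrefl (hXY z h z hz)

/-- The cluster side within `X ∪ Y` is not a clique, or a single component would do. Two nonadjacent
vertices in it lie on the same side of the join, and the other side collapses. -/
theorem exists_eq_singleton_of_join [Finite V] {j : ℕ} (hj : 1 ≤ j) {v : V} {X Y : Set V}
    (hv : ∀ x, ¬ G.Adj v x) (hX : v ∉ X) (hY : v ∉ Y) (hXne : X.Nonempty) (hYne : Y.Nonempty)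
    (hXY : ∀ x ∈ X, ∀ y ∈ Y, G.Adj x y) (huniv : Set.univ = insert v (X ∪ Y))
    (hnot : ¬ PolarOn G ⊤ (j + 1 : ℕ) Set.univ)
    (hpol : ∀ T ⊂ Set.univ, PolarOn G ⊤ (j + 1 : ℕ) T) :
    (∃ y, Y = {y} ∧ ¬ PolarOn G ⊤ j X) ∨ ∃ x, X = {x} ∧ ¬ PolarOn G ⊤ j Y := by
  have hj' : (1 : ℕ∞) ≤ j := by exact_mod_cast hj
  have hno : ¬ PolarOn G ⊤ j (X ∪ Y) := fun h => hnot (huniv ▸ h.insert_isolated hv)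
  obtain ⟨A, B, hS, hA, hB⟩ := hpol (X ∪ Y) ⟨Set.subset_univ _, fun h => by
    rcases h (Set.mem_univ v) with h | h
    exacts [hX h, hY h]⟩
  have hclique : ¬ G.IsClique (B ∩ (X ∪ Y)) := fun h => hno
    ⟨A, B ∩ (X ∪ Y), fun x hx => (hS hx).imp_right fun hB => ⟨hB, hx⟩, hA,
      clusOn_of_isClique hj' h⟩
  simp only [SimpleGraph.IsClique, Set.Pairwise] at hclique
  push Not at hclique
  obtain ⟨p, ⟨hpB, hp⟩, q, ⟨hqB, hq⟩, hpq, hnadj⟩ := hclique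
  rcases hp with hp | hp <;> rcases hq with hq | hq
  · exact Or.inl (exists_eq_singleton_of_join_aux hj hv hX hY hYne hXY hpol hS hA hB hno
      ⟨hpB, hp⟩ ⟨hqB, hq⟩ hpq hnadj)
  · exact absurd (hXY p hp q hq) hnadj
  · exact absurd (hXY q hq p hp).symm hnadj
  · rw [Set.union_comm] at hS hno
    exact Or.inr (exists_eq_singleton_of_join_aux hj hv hY hX hXne
      (fun y hy x hx => (hXY x hx y hy).symm) hpol hS hA hB hno
      ⟨hpB, hp⟩ ⟨hqB, hq⟩ hpq hnadj)

end Partitions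

/-! ### Decomposition of cographs and the shape of G. -/

section Cographs

variable {V : Type*} {W : Type*} {G : SimpleGraph V} {H : SimpleGraph W}

/-- Distinctness of the four vertices is automatic once `a` and `d` are nonadjacent. -/
theorem isCograph_iff : IsCograph G ↔ ∀ a b c d, G.Adj a b → G.Adj b c → G.Adj c d →
    ¬ G.Adj a c → ¬ G.Adj b d → G.Adj a d := by
  constructor
  · intro h a b c d hab hbc hcd hac hbd
    by_contra had
    have hac' : a ≠ c := by rintro rfl; exact had hcd
    have hbd' : b ≠ d := by rintro rfl; exact had hab
    have had' : a ≠ d := by rintro rfl; exact hac hcd.symm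
    refine h ⟨⟨⟨![a, b, c, d], fun i j hij => ?_⟩, fun {i j} => ?_⟩⟩
    · have := hab.ne; have := hbc.ne; have := hcd.ne
      fin_cases i <;> fin_cases j <;> simp_all [eq_comm]
    · change G.Adj (![a, b, c, d] i) (![a, b, c, d] j) ↔ _
      rw [SimpleGraph.pathGraph_adj]
      fin_cases i <;> fin_cases j <;> simp [hab, hbc, hcd, hac, hbd, had, hab.symm, hbc.symm,
        hcd.symm, G.adj_comm c a, G.adj_comm d b, G.adj_comm d a]
  · rintro h ⟨e⟩
    have hadj : ∀ i j : Fin 4, G.Adj (e i) (e j) ↔ (i.val + 1 = j.val ∨ j.val + 1 = i.val) :=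
      fun i j => e.map_adj_iff.trans SimpleGraph.pathGraph_adj
    have := h (e 0) (e 1) (e 2) (e 3)
    simp [hadj] at this

/-- P₄ is self-complementary: the complement of the path `a b c d` is the path `b d a c`. -/
theorem IsCograph.compl (h : IsCograph G) : IsCograph Gᶜ := by
  rw [isCograph_iff] at *
  intro a b c d hab hbc hcd hac hbd
  by_contra had
  have hac' : a ≠ c := by rintro rfl; exact had hcd
  have hbd' : b ≠ d := by rintro rfl; exact had hab
  have had' : a ≠ d := by rintro rfl; exact hac hcd.symm
  rw [SimpleGraph.compl_adj] at *
  have hac2 : G.Adj a c := by by_contra h; exact hac ⟨hac', h⟩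
  have hbd2 : G.Adj b d := by by_contra h; exact hbd ⟨hbd', h⟩
  have had2 : G.Adj a d := by by_contra h; exact had ⟨had', h⟩
  exact hbc.2 (h b d a c hbd2 had2.symm hac2 (fun h => hab.2 h.symm) (fun h => hcd.2 h.symm))

theorem IsCograph.of_embedding (h : IsCograph G) (e : H ↪g G) : IsCograph H :=
  fun ⟨f⟩ => h ⟨e.comp f⟩

/-- `S` is partitioned into two nonempty parts which are completely joined or have no edges
between them. -/
def Splits (G : SimpleGraph V) (S : Set V) : Prop :=
  ∃ X Y : Set V, X.Nonempty ∧ Y.Nonempty ∧ Disjoint X Y ∧ X ∪ Y = S ∧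
    ((∀ x ∈ X, ∀ y ∈ Y, G.Adj x y) ∨ ∀ x ∈ X, ∀ y ∈ Y, ¬ G.Adj x y)

theorem splits_of_compl {S : Set V} (h : Splits Gᶜ S) : Splits G S := by
  obtain ⟨X, Y, hX, hY, hd, hS, h⟩ := h
  refine ⟨X, Y, hX, hY, hd, hS, h.symm.imp (fun h x hx y hy => ?_) fun h x hx y hy => ?_⟩
  · by_contra hxy
    exact h x hx y hy ⟨hd.ne_of_mem hx hy, hxy⟩
  · exact (h x hx y hy).2

/-- If `x` has a neighbour `c` in `Y`, the non-neighbours of `x` in `X` split off: an edge from such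
a `b` to a neighbour `a` of `x` in `X` would give an induced path `c x a b`. Otherwise `x` goes with
`X`. -/
theorem IsCograph.splits_insert_aux (h : IsCograph G) {X Y : Set V} {x : V}
    (hY : Y.Nonempty) (hd : Disjoint X Y) (hxX : x ∉ X) (hxY : x ∉ Y)
    (hXY : ∀ a ∈ X, ∀ b ∈ Y, ¬ G.Adj a b) (hx : ∃ b ∈ X, ¬ G.Adj x b) :
    Splits G (insert x (X ∪ Y)) := by
  rw [isCograph_iff] at h
  rw [Set.disjoint_left] at hd
  by_cases hc : ∃ c ∈ Y, G.Adj x c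
  · obtain ⟨c, hcY, hxc⟩ := hc
    refine ⟨{z ∈ X | ¬ G.Adj x z}, insert x ({z ∈ X | G.Adj x z} ∪ Y), hx,
      Set.insert_nonempty _ _, ?_, ?_, Or.inr ?_⟩
    · rw [Set.disjoint_left]
      rintro b ⟨hb, hxb⟩ (rfl | hb' | hb')
      exacts [hxX hb, hxb hb'.2, hd hb hb']
    · ext z
      by_cases hxz : G.Adj x z <;>
        simp only [Set.mem_union, Set.mem_insert_iff, Set.mem_ofPred_eq, hxz] <;> tauto
    · rintro b ⟨hb, hxb⟩ a (rfl | ha | ha) hba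
      · exact hxb hba.symm
      · exact hXY b hb c hcY (h c x a b hxc.symm ha.2 hba.symm
          (fun h => hXY a ha.1 c hcY h.symm) hxb).symm
      · exact hXY b hb a ha hba
  · push Not at hc
    refine ⟨insert x X, Y, Set.insert_nonempty _ _, hY, ?_, ?_, Or.inr ?_⟩
    · rw [Set.disjoint_left]
      rintro b (rfl | hb) hb'
      exacts [hxY hb', hd hb hb']
    · rw [Set.insert_union]
    · rintro b (rfl | hb) a ha
      exacts [hc a ha, hXY b hb a ha]

theorem IsCograph.splits_insert (h : IsCograph G) {X Y : Set V} {x : V} (hX : X.Nonempty)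
    (hY : Y.Nonempty) (hd : Disjoint X Y) (hx : x ∉ X ∪ Y)
    (hXY : ∀ a ∈ X, ∀ b ∈ Y, ¬ G.Adj a b) : Splits G (insert x (X ∪ Y)) := by
  have hxX : x ∉ X := fun h => hx (Or.inl h)
  have hxY : x ∉ Y := fun h => hx (Or.inr h)
  by_cases hall : ∀ b ∈ X ∪ Y, G.Adj x b
  · refine ⟨{x}, X ∪ Y, Set.singleton_nonempty x, hX.inl, by simpa using hx,
      Set.singleton_union, Or.inl ?_⟩
    rintro a rfl b hb
    exact hall b hb
  · push Not at hall
    obtain ⟨b, hb | hb, hxb⟩ := hall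
    · exact h.splits_insert_aux hY hd hxX hxY hXY ⟨b, hb, hxb⟩
    · rw [Set.union_comm]
      exact h.splits_insert_aux hX hd.symm hxY hxX
        (fun a ha b hb hab => hXY b hb a ha hab.symm) ⟨b, hb, hxb⟩

/-- Every induced subgraph with at least two vertices of a finite cograph is a disjoint union or
a join of two nonempty graphs. -/
theorem IsCograph.splits [Finite V] (h : IsCograph G) {S : Set V} (hS : S.Nontrivial) :
    Splits G S := by
  induction S, S.toFinite using Set.Finite.induction_on with
  | empty => exact absurd hS (by simp)
  | @insert x S hx _ ih =>
    by_cases hS' : S.Nontrivial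
    · obtain ⟨X, Y, hX, hY, hd, rfl, hXY⟩ := ih hS'
      rcases hXY with hXY | hXY
      -- A join is a disjoint union in the complement, again a cograph.
      · exact splits_of_compl (h.compl.splits_insert hX hY hd hx
          fun a ha b hb hab => hab.2 (hXY a ha b hb))
      · exact h.splits_insert hX hY hd hx hXY
    · rw [Set.not_nontrivial_iff] at hS'
      obtain rfl | ⟨y, rfl⟩ := hS'.eq_empty_or_singleton
      · exact absurd hS (by simp)
      · refine ⟨{x}, {y}, Set.singleton_nonempty x, Set.singleton_nonempty y, by simpa using hx,
          rfl, ?_⟩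
        simpa using em (G.Adj x y)

theorem mem_of_reachable {X : Set V} (hX : ∀ a ∈ X, ∀ b, G.Adj a b → b ∈ X) {x y : V}
    (hxy : G.Reachable x y) (hx : x ∈ X) : y ∈ X := by
  obtain ⟨p⟩ := hxy
  induction p with
  | nil => exact hx
  | cons hab _ ih => exact ih (hX _ hx _ hab)

/-- A disconnected graph with two components, one of them a single vertex `v`, has no further
separation of the vertices other than `v`. -/
theorem exists_isolated (hcomp : Nat.card G.ConnectedComponent = 2)
    (htriv : ∃ c : G.ConnectedComponent, Nat.card c.supp = 1) :
    ∃ v, (∀ x, ¬ G.Adj v x) ∧ ∀ X Y : Set V, X.Nonempty → Y.Nonempty → Disjoint X Y →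
      X ∪ Y = {v}ᶜ → ¬ ∀ x ∈ X, ∀ y ∈ Y, ¬ G.Adj x y := by
  obtain ⟨c, hc⟩ := htriv
  rw [Nat.card_coe_set_eq, Set.ncard_eq_one] at hc
  obtain ⟨v, hv⟩ := hc
  have hmem : ∀ x, G.connectedComponentMk x = c ↔ x = v := fun x => by
    rw [← SimpleGraph.ConnectedComponent.mem_supp_iff, hv, Set.mem_singleton_iff]
  have hiso : ∀ x, ¬ G.Adj v x := fun x hvx => by
    have hx : x = v := (hmem x).1
      ((SimpleGraph.ConnectedComponent.eq.2 hvx.reachable.symm).trans ((hmem v).2 rfl))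
    exact G.irrefl (hx ▸ hvx)
  refine ⟨v, hiso, ?_⟩
  rintro X Y ⟨x, hx⟩ ⟨y, hy⟩ hd hXY hnadj
  have hxv : x ≠ v := fun h => (hXY ▸ Or.inl hx : x ∈ ({v}ᶜ : Set V)) h
  have hyv : y ≠ v := fun h => (hXY ▸ Or.inr hy : y ∈ ({v}ᶜ : Set V)) h
  have hreach : G.Reachable x y := by
    rw [← SimpleGraph.ConnectedComponent.eq]
    obtain ⟨p, q, -, hpq⟩ := Nat.card_eq_two_iff.1 hcomp
    have hall : ∀ r, r = p ∨ r = q := fun r => (hpq ▸ Set.mem_univ r : r ∈ ({p, q} : Set _))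
    have h1 := (hmem x).not.2 hxv
    have h2 := (hmem y).not.2 hyv
    rcases hall c with rfl | rfl
    · exact ((hall _).resolve_left h1).trans ((hall _).resolve_left h2).symm
    · exact ((hall _).resolve_right h1).trans ((hall _).resolve_right h2).symm
  refine Set.disjoint_left.1 hd (mem_of_reachable (fun a ha b hab => ?_) hreach hx) hy
  have hb : b ∈ X ∪ Y := hXY ▸ fun h : b = v => hiso a (h ▸ hab.symm)
  exact hb.resolve_right fun hb => hnadj a ha b hb hab

/-- Adding a dominating vertex and an isolated vertex to a cograph gives a cograph. -/
theorem IsCograph.of_induce {S : Set V} {u v : V} (hS : IsCograph (G.induce S))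
    (hv : ∀ x, ¬ G.Adj v x) (hu : ∀ x ∈ S, G.Adj u x)
    (huniv : Set.univ = insert v (insert u S)) : IsCograph G := by
  rw [isCograph_iff] at *
  intro a b c d hab hbc hcd hac hbd
  -- An induced P₄ has neither an isolated nor a dominating vertex, so it would lie inside `S`.
  have hmem : ∀ x y, G.Adj x y → x = u ∨ x ∈ S := fun x y hxy =>
    (huniv ▸ Set.mem_univ x : x ∈ insert v (insert u S)).resolve_left
      fun h => hv y (h ▸ hxy)
  rcases hmem c d hcd with rfl | hc
  · rcases hmem a b hab with rfl | ha
    · exact hcd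
    · exact absurd (hu a ha).symm hac
  rcases hmem b c hbc with rfl | hb
  · rcases hmem d c hcd.symm with rfl | hd
    · exact hab
    · exact absurd (hu d hd) hbd
  rcases hmem a b hab with rfl | ha
  · exact absurd (hu c hc) hac
  rcases hmem d c hcd.symm with rfl | hd
  · exact absurd (hu b hb).symm hbd
  exact hS ⟨a, ha⟩ ⟨b, hb⟩ ⟨c, hc⟩ ⟨d, hd⟩ hab hbc hcd hac hbd

/-- The isolated vertex, the dominating vertex of the other component, and the rest of the
graph determine it up to isomorphism. -/
theorem nonempty_iso {S : Set V} {u v : V} (hv : ∀ x, ¬ G.Adj v x) (huv : v ≠ u) (hvS : v ∉ S)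
    (hu : ∀ x ∈ S, G.Adj u x) (huniv : Set.univ = insert v (insert u S)) :
    Nonempty (G ≃g SimpleGraph.sum K1 (join K1 (G.induce S))) := by
  have huS : u ∉ S := fun h => G.irrefl (hu u h)
  let f : Fin 1 ⊕ (Fin 1 ⊕ S) → V :=
    Sum.elim (fun _ => v) (Sum.elim (fun _ => u) (Subtype.val))
  have hf : Function.Bijective f := by
    constructor
    · rintro (i | i | i) (j | j | j) hij
      · rw [Subsingleton.elim i j]
      · exact absurd hij huv
      · exact absurd ((show v = j.1 from hij) ▸ j.2) hvS
      · exact absurd hij.symm huv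
      · rw [Subsingleton.elim i j]
      · exact absurd ((show u = j.1 from hij) ▸ j.2) huS
      · exact absurd ((show i.1 = v from hij) ▸ i.2) hvS
      · exact absurd ((show i.1 = u from hij) ▸ i.2) huS
      · rw [Subtype.ext hij]
    · intro x
      rcases (huniv ▸ Set.mem_univ x : x ∈ insert v (insert u S)) with rfl | rfl | hx
      exacts [⟨Sum.inl 0, rfl⟩, ⟨Sum.inr (Sum.inl 0), rfl⟩, ⟨Sum.inr (Sum.inr ⟨x, hx⟩), rfl⟩]
  refine ⟨(RelIso.mk (Equiv.ofBijective f hf) ?_ :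
    SimpleGraph.sum K1 (join K1 (G.induce S)) ≃g G).symm⟩
  rintro (i | i | i) (j | j | j)
  · simp [f, Subsingleton.elim i j]
  · simp [f, hv]
  · simp [f, hv]
  · simp [f, hv, G.adj_comm _ v]
  · simp [f, join, Subsingleton.elim i j]
  · simp [f, join, hu]
  · simp [f, hv, G.adj_comm _ v]
  · simp [f, join, hu, G.adj_comm _ u]
  · simp [f, join]

theorem exists_of_iso {H : SimpleGraph W} (φ : G ≃g SimpleGraph.sum K1 (join K1 H)) :
    ∃ (e : H ↪g G) (u v : V), (∀ x, ¬ G.Adj v x) ∧ v ≠ u ∧ v ∉ Set.range e ∧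
      (∀ x ∈ Set.range e, G.Adj u x) ∧ Set.univ = insert v (insert u (Set.range e)) := by
  let ι : H ↪g SimpleGraph.sum K1 (join K1 H) :=
    { toFun := fun w => Sum.inr (Sum.inr w)
      inj' := fun a b h => by simpa using h
      map_rel_iff' := by
        intro a b
        change (join K1 H).Adj (Sum.inr a) (Sum.inr b) ↔ _
        simp [join] }
  refine ⟨(φ.symm.toEmbedding).comp ι, φ.symm (Sum.inr (Sum.inl 0)), φ.symm (Sum.inl 0),
    fun x => ?_, ?_, ?_, ?_, ?_⟩
  · obtain ⟨y, rfl⟩ := φ.symm.surjective x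
    rw [φ.symm.map_adj_iff]
    rcases y with y | y | y
    · simp [Subsingleton.elim y 0]
    · simp
    · simp
  · simp
  · rintro ⟨w, hw⟩
    have : ι w = Sum.inl 0 := φ.symm.injective hw
    simp [ι] at this
  · rintro _ ⟨w, rfl⟩
    change G.Adj _ (φ.symm (ι w))
    rw [φ.symm.map_adj_iff]
    change (join K1 H).Adj (Sum.inl 0) (Sum.inr w)
    simp [join]
  · refine (Set.eq_univ_of_forall fun x => ?_).symm
    obtain ⟨y, rfl⟩ := φ.symm.surjective x
    rcases y with y | y | y
    · rw [Subsingleton.elim y 0]; exact Or.inl rfl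
    · rw [Subsingleton.elim y 0]; exact Or.inr (Or.inl rfl)
    · exact Or.inr (Or.inr ⟨y, rfl⟩)

/-- The structure of a minimal obstruction with an isolated vertex `v` whose other vertices form
a connected graph. -/
theorem exists_dominating [Finite V] {j : ℕ} (hj : 1 ≤ j) (hG : IsCograph G) {v : V}
    (hv : ∀ x, ¬ G.Adj v x)
    (hconn : ∀ X Y : Set V, X.Nonempty → Y.Nonempty → Disjoint X Y →
      X ∪ Y = {v}ᶜ → ¬ ∀ x ∈ X, ∀ y ∈ Y, ¬ G.Adj x y)
    (hnot : ¬ PolarOn G ⊤ (j + 1 : ℕ) Set.univ)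
    (hpol : ∀ T ⊂ Set.univ, PolarOn G ⊤ (j + 1 : ℕ) T) :
    ∃ (u : V) (S : Set V), v ≠ u ∧ v ∉ S ∧ (∀ x ∈ S, G.Adj u x) ∧
      Set.univ = insert v (insert u S) ∧ ¬ (G.induce S).Preconnected := by
  have hj' : (1 : ℕ∞) ≤ j := by exact_mod_cast hj
  have hpc : ∀ S : Set V, G.IsClique S → PolarOn G ⊤ j S := fun S hS =>
    ⟨∅, S, by simp, ⟨0, by simp, by simp⟩, clusOn_of_isClique hj' hS⟩
  have hnontriv : ∀ S : Set V, ¬ PolarOn G ⊤ j S → S.Nontrivial := fun S hS => by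
    by_contra h
    exact hS (hpc S ((Set.not_nontrivial_iff.1 h).pairwise _))
  have hunivC : Set.univ = insert v ({v}ᶜ : Set V) := by
    rw [Set.insert_eq, Set.union_compl_self]
  obtain ⟨X, Y, hX, hY, hd, hXYc, hXY⟩ := hG.splits
    (hnontriv {v}ᶜ fun h => hnot (hunivC ▸ h.insert_isolated hv))
  replace hXY := hXY.resolve_right (hconn X Y hX hY hd hXYc)
  have hvX : v ∉ X := fun h => (hXYc ▸ Or.inl h : v ∈ ({v}ᶜ : Set V)) rfl
  have hvY : v ∉ Y := fun h => (hXYc ▸ Or.inr h : v ∈ ({v}ᶜ : Set V)) rfl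
  obtain ⟨u, S, huv, hvS, hu, huniv, hS⟩ : ∃ (u : V) (S : Set V), v ≠ u ∧ v ∉ S ∧
      (∀ x ∈ S, G.Adj u x) ∧ Set.univ = insert v (insert u S) ∧ ¬ PolarOn G ⊤ j S := by
    rcases exists_eq_singleton_of_join hj hv hvX hvY hX hY hXY (hXYc ▸ hunivC) hnot hpol with
      ⟨u, rfl, h⟩ | ⟨u, rfl, h⟩
    · exact ⟨u, X, by simpa using hvY, hvX, fun x hx => (hXY x hx u rfl).symm,
        by rw [hunivC, ← hXYc, Set.union_singleton], h⟩
    · exact ⟨u, Y, by simpa using hvX, hvY, hXY u rfl,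
        by rw [hunivC, ← hXYc, Set.singleton_union], h⟩
  refine ⟨u, S, huv, hvS, hu, huniv, fun hpre => ?_⟩
  obtain ⟨D, E, hD, hE, hd, rfl, hDE | hDE⟩ := hG.splits (hnontriv S hS)
  · -- a join of three nonempty parts would have to be a triangle
    have key : ∀ D E : Set V, D.Nonempty → E.Nonempty → v ∉ D → v ∉ E →
        (∀ x ∈ D, ∀ y ∈ E, G.Adj x y) → (∀ x ∈ D ∪ E, G.Adj u x) →
        Set.univ = insert v (insert u (D ∪ E)) →
        ∃ x, D = {x} ∧ ¬ PolarOn G ⊤ j (insert u E) := by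
      intro D E hD hE hvD hvE hDE hu huniv
      -- View C as the join of `D` and `{u} ∪ E`; the second side has at least two vertices, so `D`
      -- has one.
      refine (exists_eq_singleton_of_join hj hv hvD (by simp [huv, hvE]) hD
        (Set.insert_nonempty u E) ?_ (by rw [Set.union_insert, huniv]) hnot hpol).resolve_left ?_
      · rintro x hx y (rfl | hy)
        exacts [(hu x (Or.inl hx)).symm, hDE x hx y hy]
      · rintro ⟨y, hy, -⟩
        obtain ⟨z, hz⟩ := hE
        have h1 : u = y := (hy ▸ Or.inl rfl : u ∈ ({y} : Set V))
        have h2 : z = y := (hy ▸ Or.inr hz : z ∈ ({y} : Set V))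
        exact (hu z (Or.inr hz)).ne (h1.trans h2.symm)
    have hvD : v ∉ D := fun h => hvS (Or.inl h)
    have hvE : v ∉ E := fun h => hvS (Or.inr h)
    obtain ⟨x, rfl, hno⟩ := key D E hD hE hvD hvE hDE hu huniv
    obtain ⟨y, rfl, -⟩ := key E {x} hE hD hvE hvD (fun a ha b hb => (hDE b hb a ha).symm)
      (by rwa [Set.union_comm]) (by rwa [Set.union_comm E])
    refine hno (hpc _ ?_)
    rw [SimpleGraph.isClique_pair]
    exact fun _ => hu y (Or.inr rfl)
  · obtain ⟨x, hx⟩ := hD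
    obtain ⟨y, hy⟩ := hE
    refine Set.disjoint_left.1 hd (mem_of_reachable (X := Subtype.val ⁻¹' D) (fun a ha b hab => ?_)
      (hpre ⟨x, Or.inl hx⟩ ⟨y, Or.inr hy⟩) hx) hy
    exact b.2.resolve_right fun hb => hDE a ha b hb hab

end Cographs

end PolarCograph

open PolarCograph in
theorem mainTheorem6 (k : ℕ) (hk : 2 ≤ k) {V : Type u} [Finite V] (G : SimpleGraph V)
    (hcomp : Nat.card G.ConnectedComponent = 2)
    (htriv : ∃ c : G.ConnectedComponent, Nat.card c.supp = 1) :
    PolarCograph.IsCographMinObstruction (⊤ : ℕ∞) (k : ℕ∞) G ↔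
      ∃ (W : Type u) (_ : Finite W) (H' : SimpleGraph W),
        ¬ H'.Preconnected ∧
        PolarCograph.IsCographMinObstruction (⊤ : ℕ∞) ((k - 1 : ℕ) : ℕ∞) H' ∧
        PolarCograph.IsPolar (1 : ℕ∞) (k : ℕ∞) H' ∧
        Nonempty (G ≃g SimpleGraph.sum PolarCograph.K1
          (PolarCograph.join PolarCograph.K1 H')) := by
  -- `k ≥ 2` gives `j ≥ 1`, so that a clique always counts as a j-cluster.
  obtain ⟨j, rfl⟩ : ∃ j, k = j + 1 := ⟨k - 1, by omega⟩
  have hj : 1 ≤ j := by omega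
  rw [Nat.add_sub_cancel,
    isCographMinObstruction_iff_of_embedding (SimpleGraph.Embedding.refl (G := G))]
  have hrange : Set.range (SimpleGraph.Embedding.refl (G := G)) = Set.univ := Set.range_id
  rw [hrange]
  constructor
  · rintro ⟨hG, hmin⟩
    obtain ⟨v, hv, hconn⟩ := exists_isolated hcomp htriv
    obtain ⟨u, S, huv, hvS, hu, huniv, hpre⟩ := exists_dominating hj hG hv hconn hmin.1 hmin.2
    obtain ⟨hS, hS1⟩ := (minimal_iff hj hv huv hvS hu huniv).1 hmin
    refine ⟨S, inferInstance, G.induce S, hpre, ?_, (isPolar_induce_iff _ _ S).2 hS1,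
      nonempty_iso hv huv hvS hu huniv⟩
    rw [isCographMinObstruction_iff_of_embedding (SimpleGraph.Embedding.induce (G := G) S),
      range_embedding_induce]
    exact ⟨hG.of_embedding (SimpleGraph.Embedding.induce S), hS⟩
  · rintro ⟨W, _, H, -, hmin, hpol, ⟨φ⟩⟩
    obtain ⟨e, u, v, hv, huv, hve, hu, huniv⟩ := exists_of_iso φ
    rw [isCographMinObstruction_iff_of_embedding e] at hmin
    rw [isPolar_iff, ← polarOn_image_iff e, Set.image_univ] at hpol
    refine ⟨IsCograph.of_induce ?_ hv hu huniv,
      (minimal_iff hj hv huv hve hu huniv).2 ⟨hmin.2, hpol⟩⟩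
    exact hmin.1.of_embedding (e.isoInduceRange.symm.toEmbedding)
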